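/- Setting (up-down run generation). An input $I$ is a finite sequence of $N$ elements of a linearly ordered set, and an algorithm has a buffer of size $M\ge 1$. The first $M$ elements of $I$ are read into the buffer; at each time step the algorithm ejects one element of the buffer, appends it to the output, and reads the next element of $I$ (if any) into the freed slot, until everything is written. A run is a sorted or reverse-sorted sequence. $R(S)$ is the least number of runs whose concatenation is $S$, and $\mathrm{OPT}(I)$ is the minimum of $R(S)$ over all possible outputs $S$ on $I$; an algorithm with output $S$ is optimal on $I$ if $R(S)=\mathrm{OPT}(I)$. A maximal increasing run starts with the smallest element of the buffer, always continues with the smallest element of the buffer that is larger than the last element written, and ends only when no element of the buffer can continue it; maximal decreasing runs are defined symmetrically. A proper algorithm writes only maximal runs. The greedy offline algorithm writes, at each decision point (the start, and each end of a run), the longer one of the maximal increasing and the maximal decreasing run that can be written next. An input is $c$-nearly-sorted if some proper algorithm that is optimal on it writes only runs of length at least $cM$. Let $I$ be an input without duplicates. (1) If a proper algorithm produces only runs of length at least $5M$ on $I$, then it is optimal on $I$. (2) If $I$ is $5$-nearly-sorted, then the greedy offline algorithm (with any tie-breaking) is optimal on $I$, and it runs in time $O(N)$. Precisely: implemented by simulating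 both maximal runs at each decision point, with the buffer elements that can still join the simulated run kept in a leftist heap, the greedy offline algorithm takes at most $C(N+1)$ steps when an insertion into the in-memory heap or a removal of its first element counts as one step, where $C$ is an absolute constant (independent of $M$ and $I$); and it takes at most $C(N+1)(\lfloor\log_2 M\rfloor+1)$ steps when every step inside the heap is counted as well, which is linear in $N$ for each fixed buffer size $M$. -/

import Mathlib

namespace RunGen

variable {α : Type*} [LinearOrder α]

/-! ## The up-down run generation problem

An input is a list `I` of elements in arrival order, and `M` is the size of the buffer.
The state of an algorithm is its *unwritten-element sequence* `u`: the contents of the buffer, in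
arrival order, followed by the part of the input that has not been read.  The buffer is always full
(as long as there are enough elements), so the buffer is exactly `u.take M`, and ejecting an element
of the buffer while ingesting the next element of the input changes `u` to `u.erase x`. -/

/-- The direction of a run. -/
inductive Dir
  | up
  | down

/-- `d.le x y`: in a run of direction `d` the element `y` may come after `x`. -/
def Dir.le : Dir → α → α → Prop
  | .up, x, y => x ≤ y
  | .down, x, y => y ≤ x

instance (d : Dir) (x y : α) : Decidable (d.le x y) :=
  match d with
  | .up => inferInstanceAs (Decidable (x ≤ y))
  | .down => inferInstanceAs (Decidable (y ≤ x))

/-- `IsOutput M u S`: the sequence `S` can be written, with a buffer of size `M`, by some algorithm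
whose unwritten-element sequence is `u`; at each time step any element of the buffer is ejected. -/
inductive IsOutput (M : ℕ) : List α → List α → Prop
  | nil : IsOutput M [] []
  | write {u S : List α} {x : α} :
      x ∈ u.take M → IsOutput M (u.erase x) S → IsOutput M u (x :: S)

/-- A run is a sorted or reverse-sorted sequence. -/
def IsRun (r : List α) : Prop :=
  r.Pairwise (fun x y => x ≤ y) ∨ r.Pairwise (fun x y => y ≤ x)

/-- `R(S)`: the smallest number of runs whose concatenation is `S`. -/
noncomputable def numRuns (S : List α) : ℕ :=
  sInf {k | ∃ L : List (List α), (∀ r ∈ L, IsRun r) ∧ L.flatten = S ∧ L.length = k}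

/-- `OPT(I)`: the minimum of `R(S)` over all possible output sequences `S` on the input `I`. -/
noncomputable def opt (M : ℕ) (I : List α) : ℕ :=
  sInf {k | ∃ S, IsOutput M I S ∧ numRuns S = k}

/-- `RunFrom M d x u r u'`: a maximal run of direction `d` whose last written element is `x`
continues from the unwritten-element sequence `u` with the elements `r`, leaving `u'`.  Each time the
first element (in direction `d`) of the buffer that can continue the run is written, and the run
ends only when no element of the buffer can continue it. -/
inductive RunFrom (M : ℕ) (d : Dir) : α → List α → List α → List α → Prop
  | finish {x : α} {u : List α} : (∀ y ∈ u.take M, ¬ d.le x y) → RunFrom M d x u [] u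
  | step {x y : α} {u r u' : List α} :
      y ∈ u.take M → d.le x y → (∀ z ∈ u.take M, d.le x z → d.le y z) →
      RunFrom M d y (u.erase y) r u' → RunFrom M d x u (y :: r) u'

/-- `MaximalRun M d u r u'`: `r` is the maximal run of direction `d` from the unwritten-element
sequence `u`, and `u'` is the unwritten-element sequence after it.  It starts with the first element
(smallest for an up run, largest for a down run) of the buffer. -/
inductive MaximalRun (M : ℕ) (d : Dir) : List α → List α → List α → Prop
  | start {x : α} {u r u' : List α} :
      x ∈ u.take M → (∀ z ∈ u.take M, d.le x z) →
      RunFrom M d x (u.erase x) r u' → MaximalRun M d u (x :: r) u'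

/-- `ProperOutput M u L`: some proper algorithm (one that always writes maximal runs), started on
`u`, writes exactly the runs in the list `L`, one after the other; its output is `L.flatten`. -/
inductive ProperOutput (M : ℕ) : List α → List (List α) → Prop
  | nil : ProperOutput M [] []
  | cons {d : Dir} {u r u' : List α} {L : List (List α)} :
      MaximalRun M d u r u' → ProperOutput M u' L → ProperOutput M u (r :: L)

/-- `GreedyOutput M u L`: the greedy algorithm, which at each decision point writes a longer one of
the maximal up run and the maximal down run (with ties broken in any way), started on `u`, writes
exactly the runs in the list `L`. -/
inductive GreedyOutput (M : ℕ) : List α → List (List α) → Prop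
  | nil : GreedyOutput M [] []
  | cons {d : Dir} {u r u' : List α} {L : List (List α)} :
      MaximalRun M d u r u' →
      (∀ (d' : Dir) (r' u'' : List α), MaximalRun M d' u r' u'' → r'.length ≤ r.length) →
      GreedyOutput M u' L → GreedyOutput M u (r :: L)

/-- An input is `c`-nearly-sorted if some proper algorithm that is optimal on it writes only runs of
length at least `c * M`. -/
def NearlySorted (c M : ℕ) (I : List α) : Prop :=
  ∃ L : List (List α), ProperOutput M I L ∧ numRuns L.flatten = opt M I ∧
    ∀ r ∈ L, c * M ≤ r.length

/-! ## The greedy offline algorithm as a program with a step count -/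

/-- A computation with its result and two step counters.  `heapSteps` counts the recursive calls
made inside the heap procedure `merge`; `steps` counts everything else, so that an insertion into
the heap, or a removal of the first element, contributes a constant to `steps`. -/
structure Timed (β : Type*) where
  val : β
  steps : ℕ
  heapSteps : ℕ

/-- Return a value at no cost. -/
def Timed.ret {β : Type*} (a : β) : Timed β := ⟨a, 0, 0⟩

/-- Run `x`, then run `f` on its result; the costs add up. -/
def Timed.bind {β γ : Type*} (x : Timed β) (f : β → Timed γ) : Timed γ :=
  ⟨(f x.val).val, x.steps + (f x.val).steps, x.heapSteps + (f x.val).heapSteps⟩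

/-- Spend one step, then continue with `x`. -/
def tick {β : Type*} (x : Timed β) : Timed β := ⟨x.val, x.steps + 1, x.heapSteps⟩

/-- Spend one step inside the heap, then continue with `x`. -/
def heapTick {β : Type*} (x : Timed β) : Timed β := ⟨x.val, x.steps, x.heapSteps + 1⟩

/-- The running time when every step, also those inside the heap, is counted. -/
def Timed.time {β : Type*} (x : Timed β) : ℕ := x.steps + x.heapSteps

/-- Leftist heaps; the natural number is the length of the right spine. -/
inductive Heap (α : Type*)
  | nil : Heap α
  | node : ℕ → α → Heap α → Heap α → Heap α

/-- The stored length of the right spine. -/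
def Heap.rank {α : Type*} : Heap α → ℕ
  | .nil => 0
  | .node k _ _ _ => k

/-- The number of elements (used only to see that `merge` terminates). -/
def Heap.size {α : Type*} : Heap α → ℕ
  | .nil => 0
  | .node _ _ l r => l.size + r.size + 1

/-- The heap with root `x` and the two given subtrees. -/
def Heap.mk {α : Type*} (x : α) (l r : Heap α) : Heap α :=
  if r.rank ≤ l.rank then .node (r.rank + 1) x l r else .node (l.rank + 1) x r l

/-- Merge two heaps whose roots come first in direction `d`; every call costs one step. -/
def Heap.merge (d : Dir) : Heap α → Heap α → Timed (Heap α)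
  | .nil, b => heapTick (.ret b)
  | .node k x l r, .nil => heapTick (.ret (.node k x l r))
  | .node k x l r, .node k' x' l' r' => heapTick <|
      if d.le x x' then
        (Heap.merge d r (.node k' x' l' r')).bind fun m => .ret (Heap.mk x l m)
      else
        (Heap.merge d (.node k x l r) r').bind fun m => .ret (Heap.mk x' l' m)
termination_by a b => a.size + b.size
decreasing_by all_goals simp only [Heap.size]; omega

/-- Insert the element `x`. -/
def Heap.insert (d : Dir) (x : α) (h : Heap α) : Timed (Heap α) :=
  tick (Heap.merge d (.node 1 x .nil .nil) h)

/-- Insert all elements of a list. -/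
def Heap.insertAll (d : Dir) : List α → Heap α → Timed (Heap α)
  | [], h => tick (.ret h)
  | x :: xs, h => tick <|
      (Heap.insert d x h).bind fun h' => Heap.insertAll d xs h'

/-- Simulate a maximal run of direction `d`.  The buffer consists of the elements of the heap, which
can still be written in this run, and of the list `dead` of elements that have to wait for a later
run; `rest` is the part of the input that has not been read.  In every round the root of the heap is
appended to the run, and the next element of the input (if there is one) is read.  The result
consists of the run, the buffer and the rest of the input at the end of the run.  The natural number
bounds the number of rounds. -/
def runLoop (d : Dir) : ℕ → Heap α → List α → List α → Timed (List α × List α × List α)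
  | 0, _, dead, rest => tick (.ret ([], dead, rest))
  | _ + 1, .nil, dead, rest => tick (.ret ([], dead, rest))
  | n + 1, .node _ x l r, dead, [] => tick <|
      (Heap.merge d l r).bind fun h =>
      (runLoop d n h dead []).bind fun o =>
      .ret (x :: o.1, o.2)
  | n + 1, .node _ x l r, dead, e :: rest => tick <|
      (Heap.merge d l r).bind fun h => tick <|
      if d.le x e then
        (Heap.insert d e h).bind fun h' =>
        (runLoop d n h' dead rest).bind fun o =>
        .ret (x :: o.1, o.2)
      else
        (runLoop d n h (e :: dead) rest).bind fun o =>
        .ret (x :: o.1, o.2)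

/-- Simulate the maximal run of direction `d` from the given buffer and rest of the input. -/
def simulateRun (d : Dir) (n : ℕ) (buffer rest : List α) :
    Timed (List α × List α × List α) :=
  (Heap.insertAll d buffer .nil).bind fun h => runLoop d n h [] rest

/-- The length of a list. -/
def timedLength {β : Type*} : List β → Timed ℕ
  | [] => tick (.ret 0)
  | _ :: l => tick <| (timedLength l).bind fun n => .ret (n + 1)

/-- Append the run `r` to the output `L`, one step for each element of `r`. -/
def emit {β : Type*} (r : List β) (L : List (List β)) : Timed (List (List β)) :=
  ⟨r :: L, r.length + 1, 0⟩

/-- At each decision point simulate both maximal runs, compare their lengths, and write the longer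
one.  The natural number bounds the number of unwritten elements. -/
def greedyLoop : ℕ → List α → List α → Timed (List (List α))
  | 0, _, _ => tick (.ret [])
  | _ + 1, [], _ => tick (.ret [])
  | n + 1, x :: buffer, rest => tick <|
      (simulateRun .up (n + 1) (x :: buffer) rest).bind fun up =>
      (simulateRun .down (n + 1) (x :: buffer) rest).bind fun down =>
      (timedLength up.1).bind fun a =>
      (timedLength down.1).bind fun b =>
      if b ≤ a then
        (greedyLoop n up.2.1 up.2.2).bind fun L => emit up.1 L
      else
        (greedyLoop n down.2.1 down.2.2).bind fun L => emit down.1 L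

/-- Read the first `M` elements of the input into the buffer; the result consists of the buffer and
the rest of the input. -/
def load {β : Type*} : ℕ → List β → Timed (List β × List β)
  | 0, l => tick (.ret ([], l))
  | _ + 1, [] => tick (.ret ([], []))
  | m + 1, x :: l => tick <| (load m l).bind fun o => .ret (x :: o.1, o.2)

/-- The greedy offline algorithm with a buffer of size `M`, on the input `I`; the result is the list
of the runs that it writes. -/
def greedy (M : ℕ) (I : List α) : Timed (List (List α)) :=
  (timedLength I).bind fun n =>
  (load M I).bind fun o =>
  greedyLoop n o.1 o.2

end RunGen

/-!
The state of an algorithm is described by the set `V` of unwritten elements; the arrival times of the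
elements are fixed once and for all.  A set `s` can be written as one run of direction `d` iff, when
the turn of `y ∈ s` comes, fewer than `M` unwritten elements have arrived before `y` (`Writable`), and
a maximal run is the largest such set (`MaximalRun.isMaxRun`).  Restricting a writable set to a
subset of `V` keeps it writable, so having less to write never costs more runs (`RunsCover.mono`).

Three facts carry the proof of optimality.

* An up run and a down run from the same state have fewer than `2 * M` elements in common, because a
  common element arrives among the first `2 * M - 1` (`Writable.card_inter_lt`).
* If `r` is a maximal run and the first elements written by another algorithm form a set `X` that
  misses at least `M` elements of `r`, then all of `X \ r` is in the buffer after `r`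
  (`Accessible.sdiff_subset_buf`), hence in the next maximal run, whatever its direction.
* If in that situation the other algorithm, having missed `2 * M - 1` elements of `r`, writes a run
  `s` in the direction of `r`, then `s \ r` together with the buffer after `r` is writable as a run of
  this direction after `r` (`IsMaxRun.writable_buf_union`).

Now compare a chain of maximal runs `r, r₂, …` of length at least `5 * M` with another algorithm.  If
its first run has the direction of `r`, it is contained in `r`.  Otherwise it is a set `X` with
`|X ∩ r| < 2 * M`.  By `exchange`, after one more run `s` either `X ∪ s ⊆ r ∪ r₂`, so that two runs
have gained nothing over `r, r₂`, or `(X ∪ s) \ r` shares fewer than `2 * M` elements with `r₂`, so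
that the algorithm stands to `r₂` as it stood to `r` one run earlier.
The bound `5 * M` is what is needed when `s` is opposite to `r`: `X ∪ s` then contains at most
`2 * (2 * M - 1)` elements of `r`, so it misses at least `M` of them.  If the second
case recurs up to the
last run of the chain, the algorithm has missed most of that run and is not finished, so it never
needs fewer runs than the chain (`LongChain.le`).

The first two facts also show that two maximal runs of opposite directions do not both have `3 * M`
elements (`IsMaxRun.card_lt_of_ne`).  Hence on a nearly-sorted input the greedy choice is forced, and
the greedy algorithm writes only runs of length at least `5 * M`.  The simulations at a decision
point cost `O(M + ℓ)` steps, where `ℓ` is the length of the run that is written; since `M ≤ ℓ`, the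
total is linear.  The heaps are leftist and have at most `M` elements, so that each call of `merge`
takes `O(log M)` steps inside the heap.
-/

namespace RunGen

/-! ### Runs as sets of elements -/

section Sets

variable {α : Type*} [LinearOrder α]

theorem Dir.le_total (d : Dir) (x y : α) : d.le x y ∨ d.le y x := by
  cases d
  · exact _root_.le_total x y
  · exact _root_.le_total y x

theorem Dir.le_trans {d : Dir} {x y z : α} (h : d.le x y) (h' : d.le y z) : d.le x z := by
  cases d
  · exact _root_.le_trans h h'
  · exact _root_.le_trans h' h

theorem Dir.le_antisymm {d : Dir} {x y : α} (h : d.le x y) (h' : d.le y x) : x = y := by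
  cases d
  · exact _root_.le_antisymm h h'
  · exact _root_.le_antisymm h' h

theorem Dir.le_refl (d : Dir) (x : α) : d.le x x := by
  cases d <;> exact _root_.le_refl x

theorem Dir.le_iff_of_ne {d d' : Dir} (h : d' ≠ d) {x y : α} : d'.le x y ↔ d.le y x := by
  cases d <;> cases d' <;> first | exact absurd rfl h | exact Iff.rfl

variable {M : ℕ} {pos : α → ℕ}

/-- The elements of `V` that arrive before `y`, where `pos` gives the arrival times. -/
def before (pos : α → ℕ) (V : Finset α) (y : α) : Finset α := {z ∈ V | pos z < pos y}

/-- The buffer when `V` is the set of unwritten elements. -/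
def buf (M : ℕ) (pos : α → ℕ) (V : Finset α) : Finset α := {y ∈ V | (before pos V y).card < M}

/-- The elements of `s`, in the order of direction `d`, can be written as one run when `V` is the
set of unwritten elements: when the turn of `y` comes, fewer than `M` unwritten elements arrive
before `y`.  The run need not be maximal. -/
def Writable (M : ℕ) (pos : α → ℕ) (d : Dir) (V s : Finset α) : Prop :=
  s ⊆ V ∧ ∀ y ∈ s, (before pos V y \ {z ∈ s | d.le z y}).card < M

/-- A necessary condition for the elements of `X` to be the first ones that are written, in some
order, when `V` is the set of unwritten elements: fewer than `M` elements that stay behind arrive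
before an element of `X`. -/
def Accessible (M : ℕ) (pos : α → ℕ) (V X : Finset α) : Prop :=
  X ⊆ V ∧ ∀ x ∈ X, (before pos V x \ X).card < M

/-- The largest set that can be written as one run of direction `d`. -/
def IsMaxRun (M : ℕ) (pos : α → ℕ) (d : Dir) (V r : Finset α) : Prop :=
  Writable M pos d V r ∧ ∀ s, Writable M pos d V s → s ⊆ r

omit [LinearOrder α] in
theorem mem_before {V : Finset α} {y z : α} : z ∈ before pos V y ↔ z ∈ V ∧ pos z < pos y := by
  simp [before]

omit [LinearOrder α] in
theorem mem_buf {V : Finset α} {y : α} :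
    y ∈ buf M pos V ↔ y ∈ V ∧ (before pos V y).card < M := by
  simp [buf]

theorem Writable.accessible {d : Dir} {V s : Finset α} (h : Writable M pos d V s) :
    Accessible M pos V s := by
  refine ⟨h.1, fun x hx => lt_of_le_of_lt (Finset.card_le_card ?_) (h.2 x hx)⟩
  intro z; simp only [Finset.mem_sdiff, Finset.mem_filter]; tauto

theorem Writable.sdiff {d : Dir} {V s : Finset α} (h : Writable M pos d V s) (Y : Finset α) :
    Writable M pos d (V \ Y) (s \ Y) := by
  refine ⟨Finset.sdiff_subset_sdiff h.1 le_rfl, fun y hy => ?_⟩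
  refine lt_of_le_of_lt (Finset.card_le_card ?_) (h.2 y (Finset.mem_sdiff.1 hy).1)
  intro z; simp only [Finset.mem_sdiff, Finset.mem_filter, mem_before]; tauto

theorem Accessible.union {d : Dir} {V X s : Finset α} (hX : Accessible M pos V X)
    (hs : Writable M pos d (V \ X) s) : Accessible M pos V (X ∪ s) := by
  refine ⟨Finset.union_subset hX.1 (hs.1.trans Finset.sdiff_subset), fun x hx => ?_⟩
  rcases Finset.mem_union.1 hx with hx | hx
  · refine lt_of_le_of_lt (Finset.card_le_card ?_) (hX.2 x hx)
    intro z; simp only [Finset.mem_sdiff, Finset.mem_union]; tauto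
  · refine lt_of_le_of_lt (Finset.card_le_card ?_) (hs.2 x hx)
    intro z; simp only [Finset.mem_sdiff, Finset.mem_filter, mem_before, Finset.mem_union]; tauto

theorem Accessible.sdiff {V X : Finset α} (hX : Accessible M pos V X) (r : Finset α) :
    Accessible M pos (V \ r) (X \ r) := by
  refine ⟨Finset.sdiff_subset_sdiff hX.1 le_rfl, fun x hx => ?_⟩
  refine lt_of_le_of_lt (Finset.card_le_card ?_) (hX.2 x (Finset.mem_sdiff.1 hx).1)
  intro z; simp only [Finset.mem_sdiff, mem_before]; tauto

theorem IsMaxRun.mem_of_card_lt {d : Dir} {V r : Finset α} (hr : IsMaxRun M pos d V r) {y : α}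
    (hy : y ∈ V) (h : (before pos V y \ {z ∈ r | d.le z y}).card < M) : y ∈ r := by
  refine hr.2 (insert y r) ⟨Finset.insert_subset hy hr.1.1, fun x hx => ?_⟩
    (Finset.mem_insert_self _ _)
  have key : (before pos V x \ {z ∈ r | d.le z x}).card < M := by
    rcases Finset.mem_insert.1 hx with rfl | hx
    exacts [h, hr.1.2 x hx]
  refine lt_of_le_of_lt (Finset.card_le_card ?_) key
  intro z; simp only [Finset.mem_sdiff, Finset.mem_filter, Finset.mem_insert]; tauto

theorem IsMaxRun.buf_subset {d : Dir} {V r : Finset α} (hr : IsMaxRun M pos d V r) :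
    buf M pos V ⊆ r := fun _ hy =>
  hr.mem_of_card_lt (mem_buf.1 hy).1
    (lt_of_le_of_lt (Finset.card_le_card Finset.sdiff_subset) (mem_buf.1 hy).2)

theorem IsMaxRun.eq {d : Dir} {V r r' : Finset α} (hr : IsMaxRun M pos d V r)
    (hr' : IsMaxRun M pos d V r') : r = r' :=
  (hr'.2 r hr.1).antisymm (hr.2 r' hr'.1)

/-- An element that is not written by a maximal run arrives after all smaller (in the direction of
the run) elements of the run. -/
theorem IsMaxRun.pos_lt_of_le {d : Dir} {V r : Finset α} (hr : IsMaxRun M pos d V r) {g z : α}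
    (hg : g ∈ V) (hgr : g ∉ r) (hz : z ∈ r) (hzg : d.le z g) (inj : Set.InjOn pos V) :
    pos z < pos g := by
  by_contra hlt
  have hne : pos g ≠ pos z := fun h => hgr (inj hg (hr.1.1 hz) h ▸ hz)
  refine hgr (hr.mem_of_card_lt hg (lt_of_le_of_lt (Finset.card_le_card ?_) (hr.1.2 z hz)))
  intro w
  simp only [Finset.mem_sdiff, Finset.mem_filter, mem_before]
  rintro ⟨⟨hwV, hw⟩, hw'⟩
  exact ⟨⟨hwV, by omega⟩, fun h => hw' ⟨h.1, Dir.le_trans h.2 hzg⟩⟩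

/-- Everything that is read but not written during a maximal run is in the buffer afterwards. -/
theorem IsMaxRun.subset_before {d : Dir} {V r : Finset α} (hr : IsMaxRun M pos d V r) {x : α}
    (hx : x ∈ V \ r) (hxb : x ∉ buf M pos (V \ r)) (inj : Set.InjOn pos V) :
    r ⊆ before pos V x := by
  intro z hz
  rw [Finset.mem_sdiff] at hx
  refine mem_before.2 ⟨hr.1.1 hz, ?_⟩
  by_contra hlt
  have hne : pos x ≠ pos z := fun h => hx.2 (inj hx.1 (hr.1.1 hz) h ▸ hz)
  refine hxb (mem_buf.2 ⟨Finset.mem_sdiff.2 hx,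
    lt_of_le_of_lt (Finset.card_le_card ?_) (hr.1.2 z hz)⟩)
  intro w
  simp only [Finset.mem_sdiff, Finset.mem_filter, mem_before]
  rintro ⟨⟨hwV, hwr⟩, hw⟩
  exact ⟨⟨hwV, by omega⟩, fun h => hwr h.1⟩

theorem Accessible.sdiff_subset_buf {d : Dir} {V X r : Finset α} (hX : Accessible M pos V X)
    (hr : IsMaxRun M pos d V r) (inj : Set.InjOn pos V) (hc : M ≤ (r \ X).card) :
    X \ r ⊆ buf M pos (V \ r) := by
  intro x hx
  by_contra hxb
  have hx' := Finset.mem_sdiff.1 hx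
  have hsub := hr.subset_before (Finset.mem_sdiff.2 ⟨hX.1 hx'.1, hx'.2⟩) hxb inj
  have := Finset.card_le_card (Finset.sdiff_subset_sdiff hsub (le_refl X))
  have := hX.2 x hx'.1
  omega

theorem card_filter_card_before_lt (V : Finset α) (inj : Set.InjOn pos V) (n : ℕ) :
    ({y ∈ V | (before pos V y).card < n} : Finset α).card ≤ n := by
  -- the number of earlier elements is an injective function of the element
  have hlt : ∀ x ∈ V, ∀ y ∈ V, pos x < pos y →
      (before pos V x).card < (before pos V y).card := by
    intro x hx y _ hxy
    refine Finset.card_lt_card ⟨fun z hz => ?_, fun h => ?_⟩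
    · rw [mem_before] at hz ⊢
      exact ⟨hz.1, hz.2.trans hxy⟩
    · exact lt_irrefl _ (mem_before.1 (h (mem_before.2 ⟨hx, hxy⟩))).2
  calc _ ≤ (Finset.range n).card := by
        refine Finset.card_le_card_of_injOn (fun y => (before pos V y).card) ?_ ?_
        · intro y hy
          simpa using (Finset.mem_filter.1 hy).2
        · intro x hx y hy hxy
          have hx := (Finset.mem_filter.1 hx).1
          have hy := (Finset.mem_filter.1 hy).1
          by_contra hne
          rcases lt_trichotomy (pos x) (pos y) with h | h | h
          · exact absurd hxy (hlt x hx y hy h).ne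
          · exact hne (inj hx hy h)
          · exact absurd hxy (hlt y hy x hx h).ne'
    _ = n := Finset.card_range n

theorem card_buf_le (V : Finset α) (inj : Set.InjOn pos V) : (buf M pos V).card ≤ M :=
  card_filter_card_before_lt V inj M

/-- An element written by both an up run and a down run arrives early: of the elements that arrive
before it, fewer than `M` wait when the one run writes it, fewer than `M` when the other one does,
and no element has been written by both runs at these moments. -/
theorem Writable.card_before_add_two_le {d d' : Dir} (hd : d' ≠ d) {V r s : Finset α}
    (hr : Writable M pos d V r) (hs : Writable M pos d' V s) {y : α} (hyr : y ∈ r) (hys : y ∈ s) :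
    (before pos V y).card + 2 ≤ 2 * M := by
  have hsub : before pos V y ⊆
      (before pos V y \ {z ∈ r | d.le z y}) ∪ (before pos V y \ {z ∈ s | d'.le z y}) := by
    intro z hz
    simp only [Finset.mem_union, Finset.mem_sdiff, Finset.mem_filter, hz, true_and]
    by_contra hcon
    push Not at hcon
    obtain rfl := Dir.le_antisymm hcon.1.2 ((Dir.le_iff_of_ne hd).1 hcon.2.2)
    exact lt_irrefl _ (mem_before.1 hz).2
  have h1 := Finset.card_le_card hsub
  have h2 := Finset.card_union_le (before pos V y \ {z ∈ r | d.le z y})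
    (before pos V y \ {z ∈ s | d'.le z y})
  have h3 := hr.2 y hyr
  have h4 := hs.2 y hys
  omega

theorem Writable.card_inter_lt {d d' : Dir} (hd : d' ≠ d) (hM : 0 < M) {V r s : Finset α}
    (inj : Set.InjOn pos V) (hr : Writable M pos d V r) (hs : Writable M pos d' V s) :
    (s ∩ r).card < 2 * M := by
  have hsub : s ∩ r ⊆ {y ∈ V | (before pos V y).card < 2 * M - 1} := by
    intro y hy
    rw [Finset.mem_inter] at hy
    have := hr.card_before_add_two_le hd hs hy.2 hy.1
    exact Finset.mem_filter.2 ⟨hr.1 hy.2, by omega⟩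
  have h1 := Finset.card_le_card hsub
  have h2 := card_filter_card_before_lt V inj (2 * M - 1)
  omega

/-- After the elements of `X` have been written, another run `s` is written in the direction of the
maximal run `r`.  An element `y` of `s \ r` that arrives only after the end of `r` comes later in the
order than every element `g` of `X \ r`.  Otherwise the elements of `r \ X` up to `y` wait in the
buffer when `g` is written, and those beyond `y` wait when `s` writes `y`, so that `r \ X` would be
too small. -/
theorem IsMaxRun.le_of_not_mem_buf {d : Dir} {V X r s : Finset α} (inj : Set.InjOn pos V)
    (hX : Accessible M pos V X) (hr : IsMaxRun M pos d V r) (hs : Writable M pos d (V \ X) s)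
    (hc : 2 * M ≤ (r \ X).card + 1) {y g : α} (hy : y ∈ s \ r) (hyb : y ∉ buf M pos (V \ r))
    (hg : g ∈ X \ r) : d.le g y := by
  by_contra hgy
  have hyg : d.le y g := (Dir.le_total d g y).resolve_left hgy
  rw [Finset.mem_sdiff] at hy hg
  have hyV := Finset.mem_sdiff.1 (hs.1 hy.1)
  have hrb := hr.subset_before (Finset.mem_sdiff.2 ⟨hyV.1, hy.2⟩) hyb inj
  have hsub : r \ X ⊆ (before pos V g \ X) ∪ (before pos (V \ X) y \ {z ∈ s | d.le z y}) := by
    intro z hz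
    rw [Finset.mem_sdiff] at hz
    have hzV := hr.1.1 hz.1
    rw [Finset.mem_union]
    by_cases hzy : d.le z y
    · exact Or.inl (Finset.mem_sdiff.2 ⟨mem_before.2 ⟨hzV,
        hr.pos_lt_of_le (hX.1 hg.1) hg.2 hz.1 (Dir.le_trans hzy hyg) inj⟩, hz.2⟩)
    · refine Or.inr (Finset.mem_sdiff.2 ⟨mem_before.2 ⟨Finset.mem_sdiff.2 ⟨hzV, hz.2⟩,
        (mem_before.1 (hrb hz.1)).2⟩, fun h => hzy (Finset.mem_filter.1 h).2⟩)
  have h1 := (Finset.card_le_card hsub).trans (Finset.card_union_le _ _)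
  have h2 := hX.2 g hg.1
  have h3 := hs.2 y hy.1
  omega

theorem IsMaxRun.writable_buf_union {d : Dir} {V X r s : Finset α} (inj : Set.InjOn pos V)
    (hX : Accessible M pos V X) (hr : IsMaxRun M pos d V r) (hs : Writable M pos d (V \ X) s)
    (hc : 2 * M ≤ (r \ X).card + 1) (hXb : X \ r ⊆ buf M pos (V \ r)) :
    Writable M pos d (V \ r) (buf M pos (V \ r) ∪ (s \ r)) := by
  refine ⟨Finset.union_subset (Finset.filter_subset _ _)
    (Finset.sdiff_subset_sdiff (hs.1.trans Finset.sdiff_subset) le_rfl), fun y hy => ?_⟩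
  by_cases hyb : y ∈ buf M pos (V \ r)
  · exact lt_of_le_of_lt (Finset.card_le_card Finset.sdiff_subset) (mem_buf.1 hyb).2
  have hys := (Finset.mem_union.1 hy).resolve_left hyb
  refine lt_of_le_of_lt (Finset.card_le_card ?_) (hs.2 y (Finset.mem_sdiff.1 hys).1)
  intro z
  simp only [Finset.mem_sdiff, Finset.mem_filter, mem_before, Finset.mem_union]
  rintro ⟨⟨⟨hzV, hzr⟩, hzy⟩, hz⟩
  refine ⟨⟨⟨hzV, fun hzX => ?_⟩, hzy⟩, fun h => hz ⟨Or.inr ⟨h.1, hzr⟩, h.2⟩⟩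
  have hzX' := Finset.mem_sdiff.2 ⟨hzX, hzr⟩
  exact hz ⟨Or.inl (hXb hzX'), hr.le_of_not_mem_buf inj hX hs hc hys hyb hzX'⟩

/-! ### Exchanging runs -/

/-- `V` can be written as `k` successive maximal runs of length at least `5 * M`. -/
inductive LongChain (M : ℕ) (pos : α → ℕ) : Finset α → ℕ → Prop
  | nil : LongChain M pos ∅ 0
  | cons {d : Dir} {V r : Finset α} {k : ℕ} : IsMaxRun M pos d V r → 5 * M ≤ r.card →
      LongChain M pos (V \ r) k → LongChain M pos V (k + 1)

/-- `V` can be written as `k` successive runs. -/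
inductive RunsCover (M : ℕ) (pos : α → ℕ) : Finset α → ℕ → Prop
  | nil : RunsCover M pos ∅ 0
  | cons {d : Dir} {V s : Finset α} {k : ℕ} : Writable M pos d V s →
      RunsCover M pos (V \ s) k → RunsCover M pos V (k + 1)

/-- Having fewer elements to write never costs additional runs. -/
theorem RunsCover.mono {V W : Finset α} {k : ℕ} (h : RunsCover M pos V k) (hW : W ⊆ V) :
    RunsCover M pos W k := by
  induction h generalizing W with
  | nil => rw [Finset.subset_empty.1 hW]; exact .nil
  | @cons d V s k hs _ ih =>
    have h1 := hs.sdiff (V \ W)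
    rw [Finset.sdiff_sdiff_eq_self hW] at h1
    refine .cons h1 (ih fun x hx => ?_)
    simp only [Finset.mem_sdiff, not_and, not_not] at hx ⊢
    exact ⟨hW hx.1, fun hxs => hx.2 hxs (fun _ => hx.1)⟩

/-- The exchange step for an algorithm that has written the set `X`, which has little in common with
the long run `r`, instead of `r`.  After its next run `s`, either it has written nothing outside `r`
and the next maximal run `r₂`, or what it has written outside `r` has little in common with `r₂`. -/
theorem exchange (hM : 0 < M) {V X r s r₂ : Finset α} {d d' d₂ : Dir} (inj : Set.InjOn pos V)
    (hr : IsMaxRun M pos d V r) (hrc : 5 * M ≤ r.card) (hX : Accessible M pos V X)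
    (hXr : (X ∩ r).card < 2 * M) (hs : Writable M pos d' (V \ X) s)
    (hr₂ : IsMaxRun M pos d₂ (V \ r) r₂) :
    X ∪ s ⊆ r ∪ r₂ ∨
      Accessible M pos (V \ r) ((X ∪ s) \ r) ∧ (((X ∪ s) \ r) ∩ r₂).card < 2 * M := by
  have card_sdiff : ∀ Y : Finset α, (Y ∩ r).card + (r \ Y).card = r.card := fun Y => by
    rw [Finset.inter_comm, add_comm]; exact Finset.card_sdiff_add_card_inter r Y
  have hacc := hX.union hs
  have hcX := card_sdiff X
  by_cases hd : d' = d
  · subst hd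
    have hXb : X \ r ⊆ buf M pos (V \ r) := hX.sdiff_subset_buf hr inj (by omega)
    have hZ := hr.writable_buf_union inj hX hs (by omega) hXb
    have hsubZ : (X ∪ s) \ r ⊆ buf M pos (V \ r) ∪ (s \ r) := by
      rw [Finset.union_sdiff_distrib]
      exact Finset.union_subset_union hXb le_rfl
    by_cases hd₂ : d₂ = d'
    · subst hd₂
      left
      refine sdiff_le_iff.1 ?_
      exact hsubZ.trans (hr₂.2 _ hZ)
    · right
      have inj' : Set.InjOn pos (V \ r : Finset α) := inj.mono (by simp)
      refine ⟨hacc.sdiff r, lt_of_le_of_lt (Finset.card_le_card ?_)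
        (Writable.card_inter_lt (d := d₂) (Ne.symm hd₂) hM inj' hr₂.1 hZ)⟩
      exact Finset.inter_subset_inter hsubZ le_rfl
  · left
    refine sdiff_le_iff.1 ?_
    refine Finset.Subset.trans (hacc.sdiff_subset_buf hr inj ?_) hr₂.buf_subset
    have h1 := card_sdiff (X ∪ s)
    have h2 : ((X ∪ s) ∩ r).card ≤ (X ∩ r).card + (s ∩ (r \ X)).card := by
      refine (Finset.card_le_card ?_).trans (Finset.card_union_le _ _)
      intro z
      have := fun h => Finset.mem_sdiff.1 (@hs.1 z h)
      simp only [Finset.mem_inter, Finset.mem_union, Finset.mem_sdiff]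
      tauto
    have h3 := Writable.card_inter_lt hd hM (inj.mono (by simp)) (hr.1.sdiff X) hs
    omega

/-- A chain of long maximal runs has the least possible number of runs.  The second part, needed for
the induction, is about an algorithm that has written the set `X` instead of the run `r` and has
missed most of `r`. -/
theorem longChain_le_aux (hM : 0 < M) (k : ℕ) :
    (∀ (V : Finset α) (n : ℕ), Set.InjOn pos V → LongChain M pos V n → RunsCover M pos V k →
      n ≤ k) ∧
    (∀ (V X r : Finset α) (d : Dir) (n : ℕ), Set.InjOn pos V → IsMaxRun M pos d V r →
      5 * M ≤ r.card → LongChain M pos (V \ r) n → Accessible M pos V X →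
      (X ∩ r).card < 2 * M → RunsCover M pos (V \ X) k → n ≤ k) := by
  induction k with
  | zero =>
    constructor
    · intro V n _ hV hc
      cases hc
      cases hV with
      | nil => exact le_rfl
      | cons hr hrc _ =>
        rw [Finset.subset_empty.1 hr.1.1, Finset.card_empty] at hrc
        omega
    · intro V X r d n _ hr hrc _ _ hXr hc
      -- everything is written, so `X` contains all of `r`
      have hsub : r ⊆ X ∩ r := by
        have h0 : V \ X = ∅ := by
          generalize hW : V \ X = W at hc
          cases hc
          rfl
        exact Finset.subset_inter (hr.1.1.trans (Finset.sdiff_eq_empty_iff_subset.1 h0)) le_rfl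
      have := Finset.card_le_card hsub
      omega
  | succ k ih =>
    constructor
    · intro V n inj hV hc
      cases hV with
      | nil => exact Nat.zero_le _
      | @cons d _ r n hr hrc hV =>
        cases hc with
        | @cons d' _ s _ hs hc =>
          refine Nat.succ_le_succ ?_
          by_cases hd : d' = d
          · subst hd
            exact ih.1 _ _ (inj.mono (by simp)) hV
              (hc.mono (Finset.sdiff_subset_sdiff le_rfl (hr.2 s hs)))
          · exact ih.2 V s r d n inj hr hrc hV hs.accessible
              (Writable.card_inter_lt hd hM inj hr.1 hs) hc
    · intro V X r d n inj hr hrc hV hX hXr hc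
      generalize hW : V \ X = W at hc
      cases hc with
      | @cons d' _ s _ hs hc =>
        subst hW
        generalize hU : V \ r = U at hV
        cases hV with
        | nil => exact Nat.zero_le _
        | @cons d₂ _ r₂ n hr₂ hrc₂ hV =>
          subst hU
          have inj' : Set.InjOn pos (V \ r : Finset α) := inj.mono (by simp)
          refine Nat.succ_le_succ ?_
          rcases exchange hM inj hr hrc hX hXr hs hr₂ with h | ⟨h, h'⟩
          · refine ih.1 _ _ (inj'.mono (by simp)) hV (hc.mono ?_)
            rw [sdiff_sdiff_left, sdiff_sdiff_left]
            exact Finset.sdiff_subset_sdiff le_rfl h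
          · refine ih.2 (V \ r) _ r₂ d₂ n inj' hr₂ hrc₂ hV h h' (hc.mono ?_)
            intro z
            simp only [Finset.mem_sdiff, Finset.mem_union]
            tauto

theorem LongChain.le (hM : 0 < M) {V : Finset α} {n k : ℕ} (inj : Set.InjOn pos V)
    (h : LongChain M pos V n) (h' : RunsCover M pos V k) : n ≤ k :=
  (longChain_le_aux hM k).1 V n inj h h'

/-- Two maximal runs of opposite directions are not both long. -/
theorem IsMaxRun.card_lt_of_ne (hM : 0 < M) {d d' : Dir} (hd : d' ≠ d) {V r s : Finset α}
    (inj : Set.InjOn pos V) (hr : IsMaxRun M pos d V r) (hs : Writable M pos d' V s)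
    (hrc : 3 * M ≤ r.card) : s.card < 3 * M := by
  have h1 := Writable.card_inter_lt hd hM inj hr.1 hs
  have h2 : (s ∩ r).card + (r \ s).card = r.card := by
    rw [Finset.inter_comm, add_comm]; exact Finset.card_sdiff_add_card_inter r s
  have h3 := Finset.card_le_card (hs.accessible.sdiff_subset_buf hr inj (by omega))
  have h4 := card_buf_le (M := M) (V \ r) (inj.mono (by simp))
  have h5 := Finset.card_sdiff_add_card_inter s r
  omega

end Sets

/-! ### Runs as lists, and the optimality of long maximal runs -/

section Lists

variable {α : Type*} [LinearOrder α] {M : ℕ} {pos : α → ℕ}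

theorem Dir.exists_first (d : Dir) {s : Finset α} (hs : s.Nonempty) :
    ∃ x ∈ s, ∀ y ∈ s, d.le x y := by
  cases d
  · exact s.exists_min_image id hs
  · exact s.exists_max_image id hs

/-- The list `u` is in arrival order. -/
def Arrival (pos : α → ℕ) (u : List α) : Prop := u.Pairwise fun x y => pos x < pos y

omit [LinearOrder α] in
theorem Arrival.nodup {u : List α} (hu : Arrival pos u) : u.Nodup :=
  List.Pairwise.imp (fun h => by rintro rfl; exact lt_irrefl _ h) hu

theorem Arrival.injOn {u : List α} (hu : Arrival pos u) : Set.InjOn pos (u.toFinset : Set α) := by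
  intro x hx y hy hxy
  rw [List.coe_toFinset] at hx hy
  obtain ⟨i, hi, rfl⟩ := List.getElem_of_mem hx
  obtain ⟨j, hj, rfl⟩ := List.getElem_of_mem hy
  have h := List.pairwise_iff_getElem.1 hu
  rcases lt_trichotomy i j with hij | rfl | hij
  · exact absurd hxy (h i j hi hj hij).ne
  · rfl
  · exact absurd hxy (h j i hj hi hij).ne'

theorem Arrival.of_nodup {I : List α} (hI : I.Nodup) : Arrival (fun x => I.idxOf x) I := by
  rw [Arrival, List.pairwise_iff_getElem]
  intro i j hi hj hij
  rwa [hI.idxOf_getElem, hI.idxOf_getElem]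

omit [LinearOrder α] in
theorem Arrival.sublist {u v : List α} (hu : Arrival pos u) (h : v.Sublist u) : Arrival pos v :=
  List.Pairwise.sublist h hu

theorem Arrival.mem_take_iff {u : List α} (hu : Arrival pos u) (M : ℕ) {y : α} :
    y ∈ u.take M ↔ y ∈ buf M pos u.toFinset := by
  induction u generalizing M with
  | nil => simp [mem_buf]
  | cons a u ih =>
    cases M with
    | zero => simp [mem_buf]
    | succ M =>
      have hu' := List.pairwise_cons.1 hu
      have hna : a ∉ u.toFinset := fun h => lt_irrefl _ (hu'.1 a (List.mem_toFinset.1 h))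
      rw [List.take_succ_cons, List.mem_cons, ih hu'.2, mem_buf, mem_buf]
      by_cases hya : y = a
      · subst hya
        have : before pos (y :: u).toFinset y = ∅ := by
          rw [Finset.eq_empty_iff_forall_notMem]
          intro z hz
          rw [mem_before, List.mem_toFinset, List.mem_cons] at hz
          rcases hz with ⟨rfl | hz, h⟩
          · exact lt_irrefl _ h
          · exact lt_asymm h (hu'.1 z hz)
        rw [this]
        simp
      · have h2 : y ∈ u → before pos (a :: u).toFinset y = insert a (before pos u.toFinset y) := by
          intro hy
          have := hu'.1 y hy
          ext z
          simp only [mem_before, List.toFinset_cons, Finset.mem_insert, List.mem_toFinset]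
          constructor
          · tauto
          · rintro (rfl | h) <;> tauto
        have h3 : a ∉ before pos u.toFinset y := fun h => hna (mem_before.1 h).1
        simp only [hya, false_or, List.mem_toFinset, List.mem_cons]
        refine and_congr_right fun hy => ?_
        rw [h2 hy, Finset.card_insert_of_notMem h3]
        omega

/-- The sequence `r` can be written from the unwritten-element sequence `u`, leaving `u'`. -/
inductive Writes (M : ℕ) : List α → List α → List α → Prop
  | nil {u : List α} : Writes M u [] u
  | cons {u r u' : List α} {x : α} : x ∈ u.take M → Writes M (u.erase x) r u' →
      Writes M u (x :: r) u'

theorem IsOutput.exists_writes {s S u : List α} (h : IsOutput M u (s ++ S)) :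
    ∃ u', Writes M u s u' ∧ IsOutput M u' S := by
  induction s generalizing u with
  | nil => exact ⟨u, .nil, h⟩
  | cons x s ih =>
    cases h with
    | write hx h =>
      obtain ⟨u', h1, h2⟩ := ih h
      exact ⟨u', .cons hx h1, h2⟩

theorem Writes.isOutput {u s u' S : List α} (h : Writes M u s u') (h' : IsOutput M u' S) :
    IsOutput M u (s ++ S) := by
  induction h with
  | nil => exact h'
  | cons hx _ ih => exact .write hx (ih h')

theorem Writes.perm {u s u' : List α} (h : Writes M u s u') : (s ++ u').Perm u := by
  induction h with
  | nil => exact .refl _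
  | cons hx _ ih => exact (ih.cons _).trans (List.perm_cons_erase (List.mem_of_mem_take hx)).symm

theorem Writes.sublist {u s u' : List α} (h : Writes M u s u') : u'.Sublist u := by
  induction h with
  | nil => exact .refl _
  | cons _ _ ih => exact ih.trans List.erase_sublist

theorem Writes.length_add {u s u' : List α} (h : Writes M u s u') :
    s.length + u'.length = u.length := by
  simpa using h.perm.length_eq

theorem toFinset_erase {u : List α} (hu : u.Nodup) (x : α) :
    (u.erase x).toFinset = u.toFinset.erase x := by
  ext z; simp [hu.mem_erase_iff]

theorem Writes.nodup {u s u' : List α} (h : Writes M u s u') (hu : u.Nodup) : s.Nodup :=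
  (List.nodup_append.1 (h.perm.nodup_iff.2 hu)).1

theorem Writes.toFinset_eq {u s u' : List α} (h : Writes M u s u') (hu : u.Nodup) :
    u'.toFinset = u.toFinset \ s.toFinset := by
  have h1 := h.perm.nodup_iff.2 hu
  rw [List.nodup_append] at h1
  ext z
  have h2 : z ∈ s ∨ z ∈ u' ↔ z ∈ u := by rw [← List.mem_append]; exact h.perm.mem_iff
  have h3 : z ∈ s → z ∈ u' → False := fun a b => h1.2.2 z a z b rfl
  simp only [List.mem_toFinset, Finset.mem_sdiff]
  tauto

theorem Writes.writable {d : Dir} {u s u' : List α} (h : Writes M u s u') (hu : Arrival pos u)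
    (hs : s.Pairwise d.le) : Writable M pos d u.toFinset s.toFinset := by
  induction h with
  | nil => exact ⟨by simp, by simp⟩
  | @cons u r u' x hx h ih =>
    have hsorted := List.pairwise_cons.1 hs
    have ih := ih (hu.sublist List.erase_sublist) hsorted.2
    rw [toFinset_erase hu.nodup] at ih
    have hxb := mem_buf.1 ((hu.mem_take_iff M).1 hx)
    rw [List.toFinset_cons]
    refine ⟨Finset.insert_subset hxb.1 (ih.1.trans (Finset.erase_subset _ _)), fun y hy => ?_⟩
    rcases Finset.mem_insert.1 hy with rfl | hy
    · exact lt_of_le_of_lt (Finset.card_le_card Finset.sdiff_subset) hxb.2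
    · refine lt_of_le_of_lt (Finset.card_le_card ?_) (ih.2 y hy)
      have hxy := hsorted.1 y (by simpa using hy)
      intro z
      simp only [Finset.mem_sdiff, Finset.mem_filter, mem_before, Finset.mem_insert,
        Finset.mem_erase]
      rintro ⟨⟨hz, hzy⟩, hz'⟩
      have hzx : z ≠ x := by rintro rfl; exact hz' ⟨Or.inl rfl, hxy⟩
      exact ⟨⟨⟨hzx, hz⟩, hzy⟩, fun h => hz' ⟨Or.inr h.1, h.2⟩⟩

theorem RunFrom.writes {d : Dir} {x : α} {u r u' : List α} (h : RunFrom M d x u r u') :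
    Writes M u r u' := by
  induction h with
  | finish _ => exact .nil
  | step hy _ _ _ ih => exact .cons hy ih

theorem RunFrom.pairwise {d : Dir} {x : α} {u r u' : List α} (h : RunFrom M d x u r u') :
    (x :: r).Pairwise d.le := by
  induction h with
  | finish _ => simp
  | step _ hxy _ _ ih =>
    refine List.pairwise_cons.2 ⟨fun z hz => ?_, ih⟩
    rcases List.mem_cons.1 hz with rfl | hz
    · exact hxy
    · exact Dir.le_trans hxy ((List.pairwise_cons.1 ih).1 z hz)

theorem MaximalRun.writes {d : Dir} {u r u' : List α} (h : MaximalRun M d u r u') :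
    Writes M u r u' := by
  cases h with
  | start hx _ h => exact .cons hx h.writes

theorem MaximalRun.pairwise {d : Dir} {u r u' : List α} (h : MaximalRun M d u r u') :
    r.Pairwise d.le := by
  cases h with
  | start _ _ h => exact h.pairwise

/-- An element that a maximal run leaves behind was never in the buffer when its turn came. -/
theorem RunFrom.le_card {d : Dir} {x : α} {u r u' : List α} (h : RunFrom M d x u r u')
    (hu : Arrival pos u) {y : α} (hy : y ∈ u) (hyr : y ∉ r) (hxy : d.le x y) :
    M ≤ (before pos u.toFinset y \ {z ∈ r.toFinset | d.le z y}).card := by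
  have hnot : ∀ v : List α, Arrival pos v → y ∈ v → y ∉ v.take M →
      M ≤ (before pos v.toFinset y).card := by
    intro v hv hyv hyM
    by_contra hlt
    exact hyM ((hv.mem_take_iff M).2 (mem_buf.2 ⟨by simpa using hyv, by omega⟩))
  induction h with
  | @finish x u hend =>
    simpa using hnot u hu hy fun h => hend y h hxy
  | @step x w u r u' hw hxw hmin h ih =>
    rw [List.mem_cons, not_or] at hyr
    by_cases hwy : d.le w y
    · refine (ih (hu.sublist List.erase_sublist)
        ((List.mem_erase_of_ne hyr.1).2 hy) hyr.2 hwy).trans (Finset.card_le_card ?_)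
      rw [toFinset_erase hu.nodup]
      intro z
      simp only [Finset.mem_sdiff, Finset.mem_filter, mem_before, List.toFinset_cons,
        Finset.mem_insert, Finset.mem_erase]
      rintro ⟨⟨⟨hzw, hz⟩, hzy⟩, hz'⟩
      exact ⟨⟨hz, hzy⟩, fun h => hz' ⟨h.1.resolve_left hzw, h.2⟩⟩
    · refine (hnot u hu hy fun h => hwy (hmin y h hxy)).trans (Finset.card_le_card ?_)
      intro z hz
      refine Finset.mem_sdiff.2 ⟨hz, fun hz' => hwy ?_⟩
      rw [Finset.mem_filter, List.mem_toFinset] at hz'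
      rcases List.mem_cons.1 hz'.1 with rfl | hzr
      · exact hz'.2
      · exact Dir.le_trans ((List.pairwise_cons.1 h.pairwise).1 z hzr) hz'.2

theorem MaximalRun.le_card {d : Dir} {u r u' : List α} (h : MaximalRun M d u r u')
    (hu : Arrival pos u) {y : α} (hy : y ∈ u) (hyr : y ∉ r) :
    M ≤ (before pos u.toFinset y \ {z ∈ r.toFinset | d.le z y}).card := by
  cases h with
  | @start x _ r _ hx hmin h =>
    -- the run also continues a run whose last element is the first element `w` of `u`
    obtain ⟨w, hw, hwmin⟩ := d.exists_first (s := u.toFinset) ⟨y, by simpa using hy⟩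
    have hle : ∀ z ∈ u, d.le w z := fun z hz => hwmin z (by simpa using hz)
    exact RunFrom.le_card (.step hx (hle x (List.mem_of_mem_take hx)) (fun z hz _ => hmin z hz) h)
      hu hy hyr (hle y hy)

/-- A maximal run contains every run of its direction that can be written instead. -/
theorem MaximalRun.isMaxRun {d : Dir} {u r u' : List α} (h : MaximalRun M d u r u')
    (hu : Arrival pos u) : IsMaxRun M pos d u.toFinset r.toFinset := by
  refine ⟨h.writes.writable hu h.pairwise, fun s hs => ?_⟩
  by_contra hsub
  -- the first element of `s` that the maximal run misses
  obtain ⟨y, hy, hmin⟩ := d.exists_first (Finset.sdiff_nonempty.2 hsub)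
  rw [Finset.mem_sdiff, List.mem_toFinset] at hy
  have h1 := h.le_card hu (List.mem_toFinset.1 (hs.1 hy.1)) hy.2
  have h2 := hs.2 y hy.1
  refine absurd (h1.trans (Finset.card_le_card ?_)) (not_le.2 h2)
  intro z
  simp only [Finset.mem_sdiff, Finset.mem_filter, mem_before]
  rintro ⟨⟨hzV, hzy⟩, hz⟩
  refine ⟨⟨hzV, hzy⟩, fun hzs => hz ⟨?_, hzs.2⟩⟩
  by_contra hzr
  obtain rfl := Dir.le_antisymm hzs.2 (hmin z (Finset.mem_sdiff.2 ⟨hzs.1, hzr⟩))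
  exact lt_irrefl _ hzy

theorem MaximalRun.card_toFinset {d : Dir} {u r u' : List α} (h : MaximalRun M d u r u')
    (hu : u.Nodup) : r.toFinset.card = r.length :=
  List.toFinset_card_of_nodup (h.writes.nodup hu)

theorem eq_of_toFinset_eq {u v w : List α} (hu : Arrival pos u) (hv : v.Sublist u)
    (hw : w.Sublist u) (h : v.toFinset = w.toFinset) : v = w := by
  refine List.Perm.eq_of_pairwise (fun x y _ _ h1 h2 => absurd h1 (lt_asymm h2))
    (hu.sublist hv) (hu.sublist hw) ?_
  exact (List.perm_ext_iff_of_nodup (hu.nodup.sublist hv) (hu.nodup.sublist hw)).2 fun x => by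
    rw [← List.mem_toFinset, h, List.mem_toFinset]

/-- The direction determines the length of a maximal run and the sequence that it leaves. -/
theorem MaximalRun.length_eq {d : Dir} {u r u' r₂ u₂ : List α} (hu : u.Nodup)
    (h : MaximalRun M d u r u') (h₂ : MaximalRun M d u r₂ u₂) :
    r.length = r₂.length ∧ u' = u₂ := by
  have ha := Arrival.of_nodup hu
  have he := (h.isMaxRun ha).eq (h₂.isMaxRun ha)
  refine ⟨by rw [← h.card_toFinset hu, he, h₂.card_toFinset hu], ?_⟩
  refine eq_of_toFinset_eq ha h.writes.sublist h₂.writes.sublist ?_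
  rw [h.writes.toFinset_eq hu, h₂.writes.toFinset_eq hu, he]

theorem ProperOutput.longChain {u : List α} {L : List (List α)} (h : ProperOutput M u L)
    (hu : Arrival pos u) (hL : ∀ r ∈ L, 5 * M ≤ r.length) :
    LongChain M pos u.toFinset L.length := by
  induction h with
  | nil => exact .nil
  | @cons d u r u' L hr _ ih =>
    have ih := ih (hu.sublist hr.writes.sublist) fun r hr => hL r (List.mem_cons_of_mem _ hr)
    rw [hr.writes.toFinset_eq hu.nodup] at ih
    refine .cons (hr.isMaxRun hu) ?_ ih
    rw [hr.card_toFinset hu.nodup]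
    exact hL r List.mem_cons_self

theorem ProperOutput.isOutput {u : List α} {L : List (List α)} (h : ProperOutput M u L) :
    IsOutput M u L.flatten := by
  induction h with
  | nil => exact .nil
  | cons hr _ ih => exact hr.writes.isOutput ih

theorem isRun_iff {r : List α} : IsRun r ↔ ∃ d : Dir, r.Pairwise d.le := by
  constructor
  · rintro (h | h)
    exacts [⟨.up, h⟩, ⟨.down, h⟩]
  · rintro ⟨d, h⟩
    cases d
    exacts [Or.inl h, Or.inr h]

theorem ProperOutput.isRun {u : List α} {L : List (List α)} (h : ProperOutput M u L) :
    ∀ r ∈ L, IsRun r := by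
  induction h with
  | nil => simp
  | cons hr _ ih => exact List.forall_mem_cons.2 ⟨isRun_iff.2 ⟨_, hr.pairwise⟩, ih⟩

theorem IsOutput.runsCover {u : List α} {L : List (List α)} (h : IsOutput M u L.flatten)
    (hu : Arrival pos u) (hL : ∀ r ∈ L, IsRun r) : RunsCover M pos u.toFinset L.length := by
  induction L generalizing u with
  | nil => cases h; exact .nil
  | cons s L ih =>
    obtain ⟨u', hw, h'⟩ := IsOutput.exists_writes h
    obtain ⟨d, hd⟩ := isRun_iff.1 (hL s List.mem_cons_self)
    have ih := ih h' (hu.sublist hw.sublist) fun r hr => hL r (List.mem_cons_of_mem _ hr)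
    rw [hw.toFinset_eq hu.nodup] at ih
    exact .cons (hw.writable hu hd) ih

theorem exists_flatten_eq_length_eq_numRuns (S : List α) :
    ∃ L : List (List α), (∀ r ∈ L, IsRun r) ∧ L.flatten = S ∧ L.length = numRuns S := by
  refine Nat.sInf_mem (s := {k | ∃ L : List (List α), (∀ r ∈ L, IsRun r) ∧ L.flatten = S ∧
    L.length = k}) ⟨_, S.map fun x => [x], ?_, ?_, rfl⟩
  · intro r hr
    obtain ⟨x, _, rfl⟩ := List.mem_map.1 hr
    exact Or.inl (List.pairwise_singleton _ _)
  · induction S with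
    | nil => rfl
    | cons x S ih => simp [ih]

theorem numRuns_flatten_le {L : List (List α)} (hL : ∀ r ∈ L, IsRun r) :
    numRuns L.flatten ≤ L.length :=
  Nat.sInf_le ⟨L, hL, rfl, rfl⟩

/-- A proper algorithm that writes only runs of length at least `5 * M` is optimal. -/
theorem ProperOutput.numRuns_eq_opt {I : List α} (hM : 0 < M) (hI : I.Nodup)
    {L : List (List α)} (h : ProperOutput M I L) (hL : ∀ r ∈ L, 5 * M ≤ r.length) :
    numRuns L.flatten = opt M I := by
  have ha := Arrival.of_nodup hI
  refine le_antisymm ?_ (Nat.sInf_le ⟨_, h.isOutput, rfl⟩)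
  obtain ⟨S, hS, hopt⟩ : ∃ S, IsOutput M I S ∧ numRuns S = opt M I :=
    Nat.sInf_mem (s := {k | ∃ S, IsOutput M I S ∧ numRuns S = k}) ⟨_, _, h.isOutput, rfl⟩
  obtain ⟨K, hK, rfl, hlen⟩ := exists_flatten_eq_length_eq_numRuns S
  rw [← hopt, ← hlen]
  exact (numRuns_flatten_le h.isRun).trans
    ((h.longChain ha hL).le hM ha.injOn (hS.runsCover ha hK))

theorem GreedyOutput.properOutput {u : List α} {L : List (List α)} (h : GreedyOutput M u L) :
    ProperOutput M u L := by
  induction h with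
  | nil => exact .nil
  | cons hr _ _ ih => exact .cons hr ih

/-- If a longest maximal run has length at least `5 * M`, then its direction is determined. -/
theorem MaximalRun.dir_eq (hM : 0 < M) {d d' : Dir} {u r u' s v : List α} (hu : u.Nodup)
    (h : MaximalRun M d u r u') (hr : 5 * M ≤ r.length) (h' : MaximalRun M d' u s v)
    (hs : r.length ≤ s.length) : d' = d := by
  by_contra hd
  have ha := Arrival.of_nodup hu
  have := (h.isMaxRun ha).card_lt_of_ne hM hd ha.injOn (h'.isMaxRun ha).1
    (by rw [h.card_toFinset hu]; omega)
  rw [h'.card_toFinset hu] at this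
  omega

/-- When all runs can be long, the greedy choice is the only one that keeps them long. -/
theorem GreedyOutput.five_mul_le (hM : 0 < M) {u : List α} {L L' : List (List α)} (hu : u.Nodup)
    (h : GreedyOutput M u L) (h' : ProperOutput M u L') (hL' : ∀ r ∈ L', 5 * M ≤ r.length) :
    ∀ r ∈ L, 5 * M ≤ r.length := by
  induction h generalizing L' with
  | nil => simp
  | @cons d u r u' L hr hmax _ ih =>
    cases h' with
    | nil => cases hr with | start hx _ _ => simp at hx
    | @cons d' _ r' v L' hr' h' =>
      have hlong := hL' r' List.mem_cons_self
      have hle := hmax d' r' v hr'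
      obtain rfl := hr'.dir_eq hM hu hlong hr hle
      obtain ⟨_, rfl⟩ := hr.length_eq hu hr'
      exact List.forall_mem_cons.2 ⟨hlong.trans hle,
        ih (hu.sublist hr.writes.sublist) h' fun r hr => hL' r (List.mem_cons_of_mem _ hr)⟩

end Lists

/-! ### The running time of the greedy program -/

section Program

@[simp] theorem Timed.val_ret {β : Type*} (a : β) : (Timed.ret a).val = a := rfl
@[simp] theorem Timed.steps_ret {β : Type*} (a : β) : (Timed.ret a).steps = 0 := rfl
@[simp] theorem Timed.heapSteps_ret {β : Type*} (a : β) : (Timed.ret a).heapSteps = 0 := rfl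
@[simp] theorem Timed.val_bind {β γ : Type*} (x : Timed β) (f : β → Timed γ) :
    (x.bind f).val = (f x.val).val := rfl
@[simp] theorem Timed.steps_bind {β γ : Type*} (x : Timed β) (f : β → Timed γ) :
    (x.bind f).steps = x.steps + (f x.val).steps := rfl
@[simp] theorem Timed.heapSteps_bind {β γ : Type*} (x : Timed β) (f : β → Timed γ) :
    (x.bind f).heapSteps = x.heapSteps + (f x.val).heapSteps := rfl
@[simp] theorem val_tick {β : Type*} (x : Timed β) : (tick x).val = x.val := rfl
@[simp] theorem steps_tick {β : Type*} (x : Timed β) : (tick x).steps = x.steps + 1 := rfl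
@[simp] theorem heapSteps_tick {β : Type*} (x : Timed β) : (tick x).heapSteps = x.heapSteps := rfl
@[simp] theorem val_heapTick {β : Type*} (x : Timed β) : (heapTick x).val = x.val := rfl
@[simp] theorem steps_heapTick {β : Type*} (x : Timed β) : (heapTick x).steps = x.steps := rfl
@[simp] theorem heapSteps_heapTick {β : Type*} (x : Timed β) :
    (heapTick x).heapSteps = x.heapSteps + 1 := rfl

/-- The elements of a heap, with multiplicity. -/
def Heap.elems {α : Type*} : Heap α → Multiset α
  | .nil => 0
  | .node _ x l r => x ::ₘ (l.elems + r.elems)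

@[simp] theorem Heap.rank_nil {α : Type*} : (Heap.nil : Heap α).rank = 0 := rfl
@[simp] theorem Heap.rank_node {α : Type*} (k : ℕ) (x : α) (l r : Heap α) :
    (Heap.node k x l r).rank = k := rfl

variable {α : Type*} [LinearOrder α] {M : ℕ}

/-- The heap is ordered in direction `d` and leftist, and its stored ranks are correct. -/
def Heap.Valid (d : Dir) : Heap α → Prop
  | .nil => True
  | .node k x l r => l.Valid d ∧ r.Valid d ∧ k = r.rank + 1 ∧ r.rank ≤ l.rank ∧
      ∀ y ∈ l.elems + r.elems, d.le x y

theorem Heap.Valid.two_pow_rank_le {d : Dir} {h : Heap α} (hv : h.Valid d) :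
    2 ^ h.rank ≤ h.elems.card + 1 := by
  induction h with
  | nil => simp [Heap.elems]
  | node k x l r ihl ihr =>
    obtain ⟨hl, hr, rfl, hle, _⟩ := hv
    have h1 := ihl hl
    have h2 := ihr hr
    have h3 : 2 ^ r.rank ≤ 2 ^ l.rank := Nat.pow_le_pow_right (by norm_num) hle
    simp only [Heap.rank_node, Heap.elems, Multiset.card_cons, Multiset.card_add, pow_succ]
    omega

theorem Heap.Valid.rank_le {d : Dir} {h : Heap α} (hv : h.Valid d) (hM : h.elems.card + 1 ≤ M) :
    h.rank ≤ Nat.log 2 M :=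
  Nat.le_log_of_pow_le (by norm_num) (hv.two_pow_rank_le.trans hM)

omit [LinearOrder α] in
theorem Heap.elems_mk {x : α} {l r : Heap α} :
    (Heap.mk x l r).elems = x ::ₘ (l.elems + r.elems) := by
  unfold Heap.mk
  split
  · rfl
  · rw [Heap.elems, add_comm]

theorem Heap.Valid.mk {d : Dir} {x : α} {l r : Heap α} (hl : l.Valid d) (hr : r.Valid d)
    (h : ∀ y ∈ l.elems + r.elems, d.le x y) : (Heap.mk x l r).Valid d := by
  unfold Heap.mk
  split
  · exact ⟨hl, hr, rfl, by assumption, h⟩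
  · exact ⟨hr, hl, rfl, by omega, by rwa [add_comm]⟩

theorem Heap.merge_spec (d : Dir) (a b : Heap α) (ha : a.Valid d) (hb : b.Valid d) :
    (Heap.merge d a b).val.Valid d ∧ (Heap.merge d a b).val.elems = a.elems + b.elems ∧
      (Heap.merge d a b).steps = 0 ∧ (Heap.merge d a b).heapSteps ≤ a.rank + b.rank + 1 := by
  induction a, b using Heap.merge.induct with
  | case1 b => rw [Heap.merge]; simp [hb, Heap.elems]
  | case2 k x l r => rw [Heap.merge]; simp [ha, Heap.elems]
  | case3 k x l r k' x' l' r' ih₁ ih₂ =>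
    by_cases hx : d.le x x'
    · obtain ⟨hl, hr, rfl, hle, hlow⟩ := ha
      have hlow' := hb.2.2.2.2
      obtain ⟨h1, h2, h3, h4⟩ := ih₁ hr hb
      rw [Heap.merge, if_pos hx]
      simp only [val_heapTick, steps_heapTick, heapSteps_heapTick, Timed.val_bind, Timed.steps_bind,
        Timed.heapSteps_bind, Timed.val_ret, Timed.steps_ret, Timed.heapSteps_ret]
      refine ⟨hl.mk h1 fun y hy => ?_, ?_, ?_, ?_⟩
      · rw [h2] at hy
        simp only [Heap.elems, Multiset.mem_add, Multiset.mem_cons] at hy hlow hlow'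
        rcases hy with hy | hy | rfl | hy
        · exact hlow y (Or.inl hy)
        · exact hlow y (Or.inr hy)
        · exact hx
        · exact Dir.le_trans hx (hlow' y hy)
      · rw [Heap.elems_mk, h2, ← add_assoc]
        simp only [Heap.elems, Multiset.cons_add]
      · omega
      · simp only [Heap.rank_node] at h4 ⊢
        omega
    · have hx' := (d.le_total x x').resolve_left hx
      have hlow := ha.2.2.2.2
      obtain ⟨hl, hr, rfl, hle, hlow'⟩ := hb
      obtain ⟨h1, h2, h3, h4⟩ := ih₂ ha hr
      rw [Heap.merge, if_neg hx]
      simp only [val_heapTick, steps_heapTick, heapSteps_heapTick, Timed.val_bind, Timed.steps_bind,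
        Timed.heapSteps_bind, Timed.val_ret, Timed.steps_ret, Timed.heapSteps_ret]
      refine ⟨hl.mk h1 fun y hy => ?_, ?_, ?_, ?_⟩
      · rw [h2] at hy
        simp only [Heap.elems, Multiset.mem_add, Multiset.mem_cons] at hy hlow hlow'
        rcases hy with hy | (rfl | hy) | hy
        · exact hlow' y (Or.inl hy)
        · exact hx'
        · exact Dir.le_trans hx' (hlow y hy)
        · exact hlow' y (Or.inr hy)
      · rw [Heap.elems_mk, h2]
        simp only [Heap.elems, Multiset.add_cons]
        rw [add_left_comm]
      · omega
      · simp only [Heap.rank_node] at h4 ⊢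
        omega

theorem Heap.insert_spec (d : Dir) (x : α) (h : Heap α) (hv : h.Valid d)
    (hM : h.elems.card + 1 ≤ M) :
    (Heap.insert d x h).val.Valid d ∧ (Heap.insert d x h).val.elems = x ::ₘ h.elems ∧
      (Heap.insert d x h).steps = 1 ∧ (Heap.insert d x h).heapSteps ≤ 2 * (Nat.log 2 M + 1) := by
  obtain ⟨h1, h2, h3, h4⟩ := Heap.merge_spec d (.node 1 x .nil .nil) h
    ⟨trivial, trivial, rfl, le_rfl, by simp [Heap.elems]⟩ hv
  have := hv.rank_le hM
  unfold Heap.insert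
  simp only [val_tick, steps_tick, heapSteps_tick]
  refine ⟨h1, ?_, by omega, ?_⟩
  · rw [h2]
    simp [Heap.elems]
  · simp only [Heap.rank_node] at h4
    omega

theorem Heap.insertAll_spec (d : Dir) (xs : List α) (h : Heap α) (hv : h.Valid d)
    (hM : h.elems.card + xs.length ≤ M) :
    (Heap.insertAll d xs h).val.Valid d ∧ (Heap.insertAll d xs h).val.elems = h.elems + xs ∧
      (Heap.insertAll d xs h).steps = 2 * xs.length + 1 ∧
      (Heap.insertAll d xs h).heapSteps ≤ 2 * (Nat.log 2 M + 1) * xs.length := by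
  induction xs generalizing h with
  | nil => simp [Heap.insertAll, hv]
  | cons x xs ih =>
    rw [List.length_cons] at hM
    obtain ⟨h1, h2, h3, h4⟩ := Heap.insert_spec (M := M) d x h hv (by omega)
    obtain ⟨k1, k2, k3, k4⟩ := ih (Heap.insert d x h).val h1
      (by rw [h2, Multiset.card_cons]; omega)
    simp only [Heap.insertAll, val_tick, steps_tick, heapSteps_tick, Timed.val_bind,
      Timed.steps_bind, Timed.heapSteps_bind, List.length_cons]
    refine ⟨k1, ?_, by omega, ?_⟩
    · rw [k2, h2, ← Multiset.cons_coe, Multiset.cons_add, Multiset.add_cons]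
    · rw [mul_add, mul_one]
      omega

/-- The program stores the unwritten-element sequence `u` as a buffer, in any order, and the part of
the input that has not been read. -/
def Represents (M : ℕ) (u : List α) (buffer : Multiset α) (rest : List α) : Prop :=
  (u.take M : Multiset α) = buffer ∧ u.drop M = rest

omit [LinearOrder α] in
theorem Represents.mem_iff {u rest : List α} {b : Multiset α} (h : Represents M u b rest) {x : α} :
    x ∈ u.take M ↔ x ∈ b := by
  rw [← h.1, Multiset.mem_coe]

omit [LinearOrder α] in
theorem Represents.card_le {u rest : List α} {b : Multiset α} (h : Represents M u b rest) :
    b.card ≤ M := by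
  rw [← h.1, Multiset.coe_card]
  exact List.length_take_le _ _

omit [LinearOrder α] in
theorem Represents.length_eq {u rest : List α} {b : Multiset α} (h : Represents M u b rest) :
    u.length = b.card + rest.length := by
  rw [← h.1, ← h.2, Multiset.coe_card, ← List.length_append, List.take_append_drop]

theorem Represents.erase {u rest : List α} {b : Multiset α} {x : α}
    (h : Represents M u (x ::ₘ b) rest) :
    Represents M (u.erase x) (b + (rest.take 1 : List α)) (rest.drop 1) := by
  have hx : x ∈ u.take M := h.mem_iff.2 (Multiset.mem_cons_self _ _)
  have hlen := List.length_take (i := M) (l := u)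
  have hb : (((u.take M).erase x : List α) : Multiset α) = b := by
    rw [← Multiset.coe_erase, h.1, Multiset.erase_cons_head]
  have he : u.erase x = (u.take M).erase x ++ rest := by
    conv_lhs => rw [← List.take_append_drop M u]
    rw [List.erase_append_left _ hx, h.2]
  have hle := List.length_erase_add_one hx
  have hd := congrArg List.length h.2
  rw [List.length_drop] at hd
  rw [he, ← hb]
  cases rest with
  | nil =>
    rw [List.append_nil]
    refine ⟨?_, ?_⟩
    · rw [List.take_of_length_le (by omega)]
      simp
    · rw [List.drop_eq_nil_of_le (by omega)]
      simp
  | cons e rest =>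
    rw [List.length_cons] at hd
    have hM : ((u.take M).erase x ++ [e]).length = M := by
      rw [List.length_append, List.length_singleton]
      omega
    rw [List.append_cons]
    exact ⟨by rw [List.take_left' hM]; rfl, by rw [List.drop_left' hM]; rfl⟩

/-- The loop carries out the maximal run that continues after `x`.  Each element of the run costs at
most three steps and two calls of `Heap.merge`. -/
theorem runLoop_spec (d : Dir) (n : ℕ) (x : α) (h : Heap α) (dead rest u : List α)
    (hv : h.Valid d) (hu : Represents M u (h.elems + dead) rest) (hx : ∀ y ∈ h.elems, d.le x y)
    (hdead : ∀ y ∈ dead, ¬ d.le x y) (hn : h.elems.card + rest.length ≤ n) :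
    ∃ u', RunFrom M d x u (runLoop d n h dead rest).val.1 u' ∧
      Represents M u' (runLoop d n h dead rest).val.2.1 (runLoop d n h dead rest).val.2.2 ∧
      (runLoop d n h dead rest).steps ≤ 3 * (runLoop d n h dead rest).val.1.length + 1 ∧
      (runLoop d n h dead rest).heapSteps ≤
        4 * (Nat.log 2 M + 1) * (runLoop d n h dead rest).val.1.length := by
  have hnil : ∀ {u rest : List α} {dead : List α} {x : α}, (∀ y ∈ dead, ¬ d.le x y) →
      Represents M u (0 + (dead : Multiset α)) rest →
      RunFrom M d x u [] u ∧ Represents M u dead rest := by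
    intro u rest dead x hdead hu
    rw [zero_add] at hu
    exact ⟨.finish fun y hy => hdead y (Multiset.mem_coe.1 (hu.mem_iff.1 hy)), hu⟩
  induction n generalizing x h dead rest u with
  | zero =>
    have h0 : h.elems = 0 := Multiset.card_eq_zero.1 (by omega)
    rw [h0] at hu
    obtain ⟨h1, h2⟩ := hnil hdead hu
    exact ⟨u, h1, h2, by simp [runLoop], by simp [runLoop]⟩
  | succ n ih =>
    cases h with
    | nil =>
      obtain ⟨h1, h2⟩ := hnil hdead hu
      exact ⟨u, h1, h2, by simp [runLoop], by simp [runLoop]⟩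
    | node k y l r =>
      obtain ⟨hl, hr, -, -, hlow⟩ := hv
      obtain ⟨m1, m2, m3, m4⟩ := Heap.merge_spec d l r hl hr
      have hu' : Represents M u (y ::ₘ (l.elems + r.elems + dead)) rest := by
        rw [← Multiset.cons_add]
        exact hu
      have hcard := hu'.card_le
      simp only [Multiset.card_cons, Multiset.card_add] at hcard
      have hlr := hl.rank_le (M := M) (by omega)
      have hrr := hr.rank_le (M := M) (by omega)
      have hyu : y ∈ u.take M := hu'.mem_iff.2 (Multiset.mem_cons_self _ _)
      have hxy : d.le x y := hx y (by simp [Heap.elems])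
      have hmin : ∀ z ∈ u.take M, d.le x z → d.le y z := by
        intro z hz hxz
        rw [hu'.mem_iff, Multiset.mem_cons, Multiset.mem_add, Multiset.mem_coe] at hz
        rcases hz with rfl | hz | hz
        · exact d.le_refl z
        · exact hlow z hz
        · exact absurd hxz (hdead z hz)
      have hdead' : ∀ z ∈ dead, ¬ d.le y z := fun z hz h => hdead z hz (Dir.le_trans hxy h)
      have herase := hu'.erase
      simp only [Heap.elems, Multiset.card_cons, Multiset.card_add] at hn
      cases rest with
      | nil =>
        obtain ⟨u', k1, k2, k3, k4⟩ := ih y (Heap.merge d l r).val dead [] (u.erase y) m1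
          (by simpa [m2] using herase) (by simpa only [m2] using hlow) hdead'
          (by rw [m2, Multiset.card_add, List.length_nil]; omega)
        simp only [runLoop, val_tick, steps_tick, heapSteps_tick, Timed.val_bind,
          Timed.steps_bind, Timed.heapSteps_bind, Timed.val_ret, Timed.steps_ret,
          Timed.heapSteps_ret, List.length_cons]
        refine ⟨u', .step hyu hxy hmin k1, k2, by omega, ?_⟩
        rw [mul_add, mul_one]
        omega
      | cons e rest =>
        simp only [runLoop, val_tick, steps_tick, heapSteps_tick, Timed.val_bind,
          Timed.steps_bind, Timed.heapSteps_bind]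
        simp only [List.take_succ_cons, List.take_zero, List.drop_succ_cons, List.drop_zero]
          at herase
        rw [List.length_cons] at hn
        by_cases hye : d.le y e
        · obtain ⟨i1, i2, i3, i4⟩ := Heap.insert_spec (M := M) d e _ m1
            (by rw [m2, Multiset.card_add]; omega)
          rw [m2] at i2
          obtain ⟨u', k1, k2, k3, k4⟩ := ih y (Heap.insert d e (Heap.merge d l r).val).val dead
            rest (u.erase y) i1
            (by rw [i2, ← Multiset.singleton_add, add_assoc, add_comm]; exact herase)
            (fun z hz => by
              rw [i2, Multiset.mem_cons] at hz
              rcases hz with rfl | hz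
              exacts [hye, hlow z hz])
            hdead' (by rw [i2, Multiset.card_cons, Multiset.card_add]; omega)
          simp only [if_pos hye, Timed.val_bind, Timed.steps_bind, Timed.heapSteps_bind,
            Timed.val_ret, Timed.steps_ret, Timed.heapSteps_ret, List.length_cons]
          refine ⟨u', .step hyu hxy hmin k1, k2, by omega, ?_⟩
          rw [mul_add, mul_one]
          omega
        · obtain ⟨u', k1, k2, k3, k4⟩ := ih y (Heap.merge d l r).val (e :: dead) rest
            (u.erase y) m1
            (by
              rw [m2, ← Multiset.cons_coe, ← Multiset.singleton_add, add_comm ({e} : Multiset α),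
                ← add_assoc]
              exact herase)
            (by simpa only [m2] using hlow)
            (List.forall_mem_cons.2 ⟨hye, hdead'⟩)
            (by rw [m2, Multiset.card_add]; omega)
          simp only [if_neg hye, Timed.val_bind, Timed.steps_bind, Timed.heapSteps_bind,
            Timed.val_ret, Timed.steps_ret, Timed.heapSteps_ret, List.length_cons]
          refine ⟨u', .step hyu hxy hmin k1, k2, by omega, ?_⟩
          rw [mul_add, mul_one]
          omega

/-- The simulation writes the maximal run; the insertion of the buffer into the heap accounts for the
terms with `M`. -/
theorem simulateRun_spec (hM : 0 < M) (d : Dir) (n : ℕ) (buffer rest u : List α)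
    (hu : Represents M u buffer rest) (hne : u ≠ []) (hn : u.length ≤ n) :
    ∃ u', MaximalRun M d u (simulateRun d n buffer rest).val.1 u' ∧
      Represents M u' (simulateRun d n buffer rest).val.2.1
        (simulateRun d n buffer rest).val.2.2 ∧
      (simulateRun d n buffer rest).steps ≤
        2 * M + 3 * (simulateRun d n buffer rest).val.1.length + 2 ∧
      (simulateRun d n buffer rest).heapSteps ≤
        2 * (Nat.log 2 M + 1) * (M + 2 * (simulateRun d n buffer rest).val.1.length) := by
  have hb : buffer.length ≤ M := by simpa using hu.card_le
  obtain ⟨h1, h2, h3, h4⟩ := Heap.insertAll_spec (M := M) d buffer .nil trivial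
    (by simpa [Heap.elems] using hb)
  have h2 : (Heap.insertAll d buffer .nil).val.elems = buffer := by simpa [Heap.elems] using h2
  have hlen := hu.length_eq
  rw [Multiset.coe_card] at hlen
  -- the run also continues a run whose last element is the first element `w` of `u`
  obtain ⟨w, hw, hwmin⟩ := d.exists_first (s := u.toFinset) (by simpa using hne)
  have hle : ∀ z ∈ u, d.le w z := fun z hz => hwmin z (by simpa using hz)
  obtain ⟨u', k1, k2, k3, k4⟩ := runLoop_spec (M := M) d n w (Heap.insertAll d buffer .nil).val
    [] rest u h1 (by simpa [h2] using hu)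
    (fun y hy => hle y (List.mem_of_mem_take (hu.mem_iff.2 (h2 ▸ hy)))) (by simp)
    (by rw [h2, Multiset.coe_card]; omega)
  simp only [simulateRun, Timed.val_bind, Timed.steps_bind, Timed.heapSteps_bind]
  refine ⟨u', ?_, k2, by omega, ?_⟩
  · generalize (runLoop d n (Heap.insertAll d buffer .nil).val [] rest).val.1 = r at k1
    cases k1 with
    | finish h =>
      obtain ⟨x, hx⟩ := List.exists_mem_of_ne_nil (u.take M)
        (by simp [List.take_eq_nil_iff, hne, hM.ne'])
      exact absurd (hle x (List.mem_of_mem_take hx)) (h x hx)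
    | step hy _ hmin hr =>
      exact .start hy (fun z hz => hmin z hz (hle z (List.mem_of_mem_take hz))) hr
  · have h5 : 2 * (Nat.log 2 M + 1) * buffer.length ≤ 2 * (Nat.log 2 M + 1) * M :=
      Nat.mul_le_mul_left _ hb
    calc _ ≤ 2 * (Nat.log 2 M + 1) * M + 4 * (Nat.log 2 M + 1) *
            (runLoop d n (Heap.insertAll d buffer .nil).val [] rest).val.1.length :=
          Nat.add_le_add (h4.trans h5) k4
      _ = _ := by ring

theorem timedLength_spec {β : Type*} (l : List β) :
    timedLength l = ⟨l.length, l.length + 1, 0⟩ := by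
  induction l with
  | nil => rfl
  | cons x l ih =>
    rw [timedLength, ih]
    rfl

theorem load_spec {β : Type*} (m : ℕ) (l : List β) :
    (load m l).val = (l.take m, l.drop m) ∧ (load m l).steps ≤ l.length + 1 ∧
      (load m l).heapSteps = 0 := by
  induction m generalizing l with
  | zero => simp [load]
  | succ m ih =>
    cases l with
    | nil => simp [load]
    | cons x l =>
      obtain ⟨h1, h2, h3⟩ := ih l
      simp [load, h1, h2, h3]

/-- The greedy loop follows the greedy algorithm.  It takes linear time if the runs are long, because
the cost of a decision point is then bounded by the length of the run that is written. -/
theorem greedyLoop_spec (hM : 0 < M) (n : ℕ) (buffer rest u : List α) (hnd : u.Nodup)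
    (hu : Represents M u buffer rest) (hn : u.length ≤ n) :
    GreedyOutput M u (greedyLoop n buffer rest).val ∧
      ((∀ r ∈ (greedyLoop n buffer rest).val, 5 * M ≤ r.length) →
        (greedyLoop n buffer rest).steps ≤ 12 * u.length + 1 ∧
        (greedyLoop n buffer rest).heapSteps ≤ 10 * (Nat.log 2 M + 1) * u.length) := by
  induction n generalizing buffer rest u with
  | zero =>
    obtain rfl := List.length_eq_zero_iff.1 (Nat.le_zero.1 hn)
    exact ⟨.nil, fun _ => by simp [greedyLoop]⟩
  | succ n ih =>
    cases buffer with
    | nil =>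
      have h := hu.1
      rw [Multiset.coe_nil, Multiset.coe_eq_zero, List.take_eq_nil_iff] at h
      obtain rfl := h.resolve_left hM.ne'
      exact ⟨.nil, fun _ => by simp [greedyLoop]⟩
    | cons x buffer =>
      have hne : u ≠ [] := by
        rintro rfl
        simpa using congrArg Multiset.card hu.1
      obtain ⟨v, a1, a2, a3, a4⟩ := simulateRun_spec hM .up (n + 1) _ _ _ hu hne hn
      obtain ⟨w, b1, b2, b3, b4⟩ := simulateRun_spec hM .down (n + 1) _ _ _ hu hne hn
      simp only [greedyLoop, val_tick, steps_tick, heapSteps_tick, Timed.val_bind,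
        Timed.steps_bind, Timed.heapSteps_bind, timedLength_spec]
      generalize simulateRun .up (n + 1) (x :: buffer) rest = up at *
      generalize simulateRun .down (n + 1) (x :: buffer) rest = down at *
      -- writing the longer run `r` pays for the simulation of both runs
      have key : ∀ {d : Dir} {o : List α × List α × List α} {u' : List α},
          MaximalRun M d u o.1 u' → Represents M u' o.2.1 o.2.2 →
          up.val.1.length ≤ o.1.length → down.val.1.length ≤ o.1.length →
          GreedyOutput M u (o.1 :: (greedyLoop n o.2.1 o.2.2).val) ∧
            ((∀ r ∈ o.1 :: (greedyLoop n o.2.1 o.2.2).val, 5 * M ≤ r.length) →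
              up.steps + (down.steps + (up.val.1.length + 1 + (down.val.1.length + 1 +
                ((greedyLoop n o.2.1 o.2.2).steps + (o.1.length + 1))))) + 1 ≤
                12 * u.length + 1 ∧
              up.heapSteps + (down.heapSteps + (0 + (0 +
                ((greedyLoop n o.2.1 o.2.2).heapSteps + 0)))) ≤
                10 * (Nat.log 2 M + 1) * u.length) := by
        intro d o u' hr hu' hup hdown
        have hlen := hr.writes.length_add
        have hpos : 0 < o.1.length := by
          generalize o.1 = r at hr
          cases hr
          simp
        obtain ⟨c1, c2⟩ := ih o.2.1 o.2.2 u' (hnd.sublist hr.writes.sublist) hu' (by omega)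
        refine ⟨.cons hr (fun d' r' u'' h' => ?_) c1, fun hlong => ?_⟩
        · cases d'
          · rw [(h'.length_eq hnd a1).1]
            exact hup
          · rw [(h'.length_eq hnd b1).1]
            exact hdown
        · obtain ⟨e1, e2⟩ := c2 fun r hr => hlong r (List.mem_cons_of_mem _ hr)
          have hl := hlong o.1 List.mem_cons_self
          refine ⟨by omega, ?_⟩
          generalize Nat.log 2 M + 1 = K at *
          rw [← hlen]
          have hu4 : up.heapSteps ≤ 2 * K * (M + 2 * o.1.length) :=
            a4.trans (Nat.mul_le_mul_left _ (by omega))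
          have hd4 : down.heapSteps ≤ 2 * K * (M + 2 * o.1.length) :=
            b4.trans (Nat.mul_le_mul_left _ (by omega))
          have hm : 2 * K * (2 * (M + 2 * o.1.length)) ≤ 2 * K * (5 * o.1.length) :=
            Nat.mul_le_mul_left _ (by omega)
          linarith
      split
      · exact key a1 a2 le_rfl (by assumption)
      · exact key b1 b2 (by omega) le_rfl

theorem greedy_spec (hM : 0 < M) (I : List α) (hI : I.Nodup) :
    GreedyOutput M I (greedy M I).val ∧
      ((∀ r ∈ (greedy M I).val, 5 * M ≤ r.length) →
        (greedy M I).steps ≤ 24 * (I.length + 1) ∧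
        (greedy M I).time ≤ 24 * (I.length + 1) * (Nat.log 2 M + 1)) := by
  obtain ⟨h1, h2, h3⟩ := load_spec M I
  obtain ⟨k1, k2⟩ := greedyLoop_spec hM I.length (I.take M) (I.drop M) I hI ⟨rfl, rfl⟩ le_rfl
  simp only [greedy, Timed.time, timedLength_spec, Timed.val_bind, Timed.steps_bind,
    Timed.heapSteps_bind, h1, h3]
  refine ⟨k1, fun hlong => ?_⟩
  obtain ⟨e1, e2⟩ := k2 hlong
  refine ⟨by omega, ?_⟩
  have hm : 14 * (I.length + 1) * 1 ≤ 14 * (I.length + 1) * (Nat.log 2 M + 1) :=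
    Nat.mul_le_mul_left _ (by omega)
  have hm' : 10 * (Nat.log 2 M + 1) * I.length ≤ 10 * (Nat.log 2 M + 1) * (I.length + 1) :=
    Nat.mul_le_mul_left _ (by omega)
  linarith

end Program

end RunGen

theorem mainTheorem10 :
    (∀ {α : Type*} [LinearOrder α] (M : ℕ) (I : List α), 0 < M → I.Nodup →
      ∀ L : List (List α), RunGen.ProperOutput M I L → (∀ r ∈ L, 5 * M ≤ r.length) →
        RunGen.numRuns L.flatten = RunGen.opt M I) ∧
    ∃ C : ℕ, ∀ {α : Type*} [LinearOrder α] (M : ℕ) (I : List α), 0 < M → I.Nodup →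
      RunGen.NearlySorted 5 M I →
        (∀ L : List (List α), RunGen.GreedyOutput M I L →
          RunGen.numRuns L.flatten = RunGen.opt M I) ∧
        RunGen.GreedyOutput M I (RunGen.greedy M I).val ∧
        (RunGen.greedy M I).steps ≤ C * (I.length + 1) ∧
        (RunGen.greedy M I).time ≤ C * (I.length + 1) * (Nat.log 2 M + 1) := by
  refine ⟨fun M I hM hI L h hL => h.numRuns_eq_opt hM hI hL, 24, ?_⟩
  rintro α _ M I hM hI ⟨L', hL', -, hlong⟩
  obtain ⟨h1, h2⟩ := RunGen.greedy_spec hM I hI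
  obtain ⟨h3, h4⟩ := h2 (h1.five_mul_le hM hI hL' hlong)
  exact ⟨fun L h => h.properOutput.numRuns_eq_opt hM hI (h.five_mul_le hM hI hL' hlong),
    h1, h3, h4⟩
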